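/- Consider the maximization of a monotone submodular function $f\colon 2^E\to\mathbb{R}_{\ge 0}$ on a ground set $E$ with $n=|E|$ elements, subject to a cardinality constraint $|S|\le K$, in the single-pass element-store streaming model. There the elements $e_1,\dots,e_n$ of $E$ arrive one by one in an arbitrary order; the algorithm maintains a set $S\subseteq E$, initially empty, and an additional memory $M$. When $e_t$ arrives, it updates $S$ (to a subset of $S\cup\{e_t\}$) and $M$ using only the content of $M$ and the values $f(S')$ for $S'\subseteq S\cup\{e_t\}$. At the end it outputs a subset of $S$. Its space is the maximum number of words stored in $M$ plus the maximum size of $S$ during the run; its computational power is unlimited. A randomized algorithm has approximation ratio $\alpha$ if on every input its output is a set of at most $K$ elements, with expected value at least $\alpha\cdot\max_{|T|\le K}f(T)$. Theorem. For every $\varepsilon>0$ there are a constant $c>0$ and an integer $K_0$, depending only on $\varepsilon$, such that for every $K\ge K_0$ and every $n$, every randomized single-pass algorithm in the element-store model for inputs with $n$ elements and cardinality constraint $K$ that has approximation ratio $\frac{2}{2+\sqrt2}+\varepsilon$ ($\approx 0.585+\varepsilon$) requires space at least $c\,n/K^2$; that is, it requires $\Omega(n/K^2)$ space, with a hidden constant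 that depends only on $\varepsilon$. -/

import Mathlib

open MeasureTheory

namespace ElementStore

/-- A set function is monotone if `f S ≤ f T` for all `S ⊆ T`. -/
def IsMonotone {E : Type*} (f : Finset E → ℝ) : Prop :=
  ∀ S T : Finset E, S ⊆ T → f S ≤ f T

/-- Submodularity, as the diminishing marginal return property. -/
def IsSubmodular {E : Type*} [DecidableEq E] (f : Finset E → ℝ) : Prop :=
  ∀ S T : Finset E, S ⊆ T → ∀ e : E, e ∉ T →
    f (insert e T) - f T ≤ f (insert e S) - f S

/-- An input of the streaming problem on `n` elements: a non-negative monotone submodular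
function on the subsets of the ground set `Fin n`, and the order in which the elements arrive
(the `t`-th item of the stream, counted from `0`, is `order t`). -/
structure StreamInstance (n : ℕ) where
  f : Finset (Fin n) → ℝ
  nonneg : ∀ S, 0 ≤ f S
  mono : IsMonotone f
  submod : IsSubmodular f
  order : Equiv.Perm (Fin n)

/-- A deterministic single-pass algorithm in the element-store model. It maintains a set `S` of
elements and an additional memory, a finite list of words from an arbitrary type `W`.
When `e` arrives, the pair is updated using the current content of the memory and the values of
`f` at the subsets of `S ∪ {e}` only; the new set of elements is a subset of `S ∪ {e}`.
At the end a subset of the stored set is output. There is no bound on the computational power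
of the updates. -/
structure Algorithm (n : ℕ) (W : Type*) where
  /-- initial content of the additional memory -/
  init : List W
  /-- update upon the arrival of `e`, given the oracle on the subsets of `S ∪ {e}` -/
  step : (S : Finset (Fin n)) → List W → (e : Fin n) →
    ({T : Finset (Fin n) // T ⊆ insert e S} → ℝ) →
      {S' : Finset (Fin n) // S' ⊆ insert e S} × List W
  /-- final output, given the oracle on the subsets of `S` -/
  out : (S : Finset (Fin n)) → List W → ({T : Finset (Fin n) // T ⊆ S} → ℝ) →
    {O : Finset (Fin n) // O ⊆ S}

namespace Algorithm

variable {n : ℕ} {W : Type*}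

/-- The stored set and the content of the memory after `t` steps; the run stops after step `n`.
The stored set is initially empty. -/
def state (A : Algorithm n W) (I : StreamInstance n) : ℕ → Finset (Fin n) × List W
  | 0 => (∅, A.init)
  | t + 1 =>
    if h : t < n then
      let p := A.step (A.state I t).1 (A.state I t).2 (I.order ⟨t, h⟩) (fun T => I.f T.1)
      (p.1.1, p.2)
    else A.state I t

/-- The set that is output at the end of the stream. -/
def output (A : Algorithm n W) (I : StreamInstance n) : Finset (Fin n) :=
  (A.out (A.state I n).1 (A.state I n).2 (fun T => I.f T.1)).1

/-- The space used on an input: the maximum number of words in the memory plus the maximum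
number of stored elements. -/
def space (A : Algorithm n W) (I : StreamInstance n) : ℕ :=
  (Finset.range (n + 1)).sup (fun t => (A.state I t).2.length) +
    (Finset.range (n + 1)).sup (fun t => (A.state I t).1.card)

end Algorithm

/-- A randomized algorithm: a deterministic algorithm chosen by a random seed `ω`, such that on
each input the output is a random variable. -/
structure RandomizedAlgorithm (n : ℕ) (W : Type*) (Ω : Type*) [MeasurableSpace Ω] where
  law : Measure Ω
  isProb : IsProbabilityMeasure law
  alg : Ω → Algorithm n W
  measurable_output : ∀ (I : StreamInstance n) (O : Finset (Fin n)),
    MeasurableSet {ω | (alg ω).output I = O}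

namespace RandomizedAlgorithm

variable {n : ℕ} {W Ω : Type*} [MeasurableSpace Ω]

/-- Approximation ratio `α` for maximization subject to `|S| ≤ K`: on every input the output is
feasible almost surely and its expected value is at least `α` times the optimal value. -/
def HasApproxRatio (A : RandomizedAlgorithm n W Ω) (K : ℕ) (α : ℝ) : Prop :=
  ∀ I : StreamInstance n,
    (∀ᵐ ω ∂A.law, ((A.alg ω).output I).card ≤ K) ∧
      ∀ T : Finset (Fin n), T.card ≤ K →
        α * I.f T ≤ ∫ ω, I.f ((A.alg ω).output I) ∂A.law

/-- On every input, the algorithm almost surely uses space at most `s`. -/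
def UsesSpaceAtMost (A : RandomizedAlgorithm n W Ω) (s : ℕ) : Prop :=
  ∀ I : StreamInstance n, ∀ᵐ ω ∂A.law, (A.alg ω).space I ≤ s

end RandomizedAlgorithm

end ElementStore

namespace ElementStore

/-! ### The hard function -/

/-! The hard input has `H = K - 1` hidden elements, one special element `w` arriving last, and
otherwise ordinary elements. Its function depends only on the number `x` of ordinary elements, the
number `h` of hidden ones, and the presence of `w`. It is tuned so that, without `w`, one hidden
element has the same marginal value as one ordinary element (`profile_one_hidden`). Hence a run
learns nothing about the hidden set unless it holds two hidden elements at once or still stores one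
when `w` arrives (`output_inter_hidden_eq_empty`). An output that misses the hidden set is worth at
most `X(X+1)/2 + HK`, while the hidden set with `w` is worth `H² + HX + X(X+1)/2`. To leading order
the quotient is `(1 + r²/2) / (1 + r + r²/2)` with `r = X/H`; it is smallest at `r = √2`, where it
equals `2/(2+√2)`. The hidden set is a random transversal of `H` blocks of size `m ≈ n/K`. For a
fixed seed, the run without hidden elements does not depend on the transversal, so a union bound
applies: with space `s`, detection has probability at most `(s n + s m)/m²`
(`card_detected_mul_le`). Averaging over transversals and seeds, an excess of order `ε` in the ratio
forces `s n/m²` to be of order `ε`, that is, `s` of order `n/K²`. -/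

/-- The rate at which `hiddenGain` decreases: constant up to `X`, geometric afterwards. -/
noncomputable def decay (H X x : ℕ) : ℝ := (1 - 1 / (H : ℝ)) ^ (x - X)

/-- The marginal value of a hidden element next to `x` ordinary ones. -/
noncomputable def hiddenGain (H X x : ℕ) : ℝ := H * decay H X x + (X - x : ℕ)

/-- The marginal value of the last element of the stream next to `x` ordinary ones. -/
noncomputable def lastGain (X x : ℕ) : ℝ := ((X - x : ℕ) : ℝ) * ((X - x : ℕ) + 1) / 2

/-- The optimal value of the hard instances. -/
noncomputable def topValue (H X : ℕ) : ℝ := (H : ℝ) ^ 2 + H * X + X * (X + 1) / 2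

/-- The value of a set with `x` ordinary elements and `h` hidden ones; `b` tells whether it
contains the last element of the stream. -/
noncomputable def profile (H X x h : ℕ) (b : Bool) : ℝ :=
  topValue H X - (H - h) * hiddenGain H X x - (if b then 0 else lastGain X x)

/-! ### Marginals and monotonicity of the profile. -/

section Profile

variable {H : ℕ}

theorem one_sub_inv_mem (hH : 1 ≤ H) : 0 ≤ 1 - 1 / (H : ℝ) ∧ 1 - 1 / (H : ℝ) ≤ 1 := by
  have h : (1 : ℝ) ≤ H := by exact_mod_cast hH
  have h1 : 1 / (H : ℝ) ≤ 1 := by rw [div_le_one (by linarith)]; exact h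
  have h2 : 0 ≤ 1 / (H : ℝ) := by positivity
  constructor <;> linarith

theorem decay_nonneg (hH : 1 ≤ H) (X x : ℕ) : 0 ≤ decay H X x := pow_nonneg (one_sub_inv_mem hH).1 _

theorem decay_antitone (hH : 1 ≤ H) (X : ℕ) : Antitone (decay H X) := fun _ _ h =>
  pow_le_pow_of_le_one (one_sub_inv_mem hH).1 (one_sub_inv_mem hH).2 (Nat.sub_le_sub_right h X)

/-- Beyond `X` only the term `H * decay` remains, and it loses the fraction `1/H` of itself in each
step; this is why the geometric ratio is `1 - 1/H`. Up to `X` the loss is 1, from the linear term.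
-/
theorem hiddenGain_succ (hH : 1 ≤ H) (X x : ℕ) :
    hiddenGain H X x - hiddenGain H X (x + 1) = decay H X x := by
  have hH0 : (H : ℝ) ≠ 0 := by positivity
  unfold hiddenGain decay
  rcases lt_or_ge x X with h | h
  · obtain ⟨k, rfl⟩ := Nat.exists_eq_add_of_lt h
    rw [show x - (x + k + 1) = 0 by omega, show x + 1 - (x + k + 1) = 0 by omega,
      show x + k + 1 - x = k + 1 by omega, show x + k + 1 - (x + 1) = k by omega]
    push_cast
    ring
  · obtain ⟨k, rfl⟩ := Nat.exists_eq_add_of_le h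
    rw [show X + k - X = k by omega, show X + k + 1 - X = k + 1 by omega,
      show X - (X + k) = 0 by omega, show X - (X + k + 1) = 0 by omega, pow_succ]
    field_simp
    ring

theorem lastGain_succ (X x : ℕ) : lastGain X x - lastGain X (x + 1) = (X - x : ℕ) := by
  unfold lastGain
  rcases lt_or_ge x X with h | h
  · obtain ⟨k, rfl⟩ := Nat.exists_eq_add_of_lt h
    rw [show x + k + 1 - x = k + 1 by omega, show x + k + 1 - (x + 1) = k by omega]
    push_cast
    ring
  · rw [show X - x = 0 by omega, show X - (x + 1) = 0 by omega]
    simp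

theorem lastGain_nonneg (X x : ℕ) : 0 ≤ lastGain X x := by unfold lastGain; positivity

theorem lastGain_antitone (X : ℕ) : Antitone (lastGain X) := antitone_nat_of_succ_le fun x => by
  have := lastGain_succ X x
  have : (0 : ℝ) ≤ (X - x : ℕ) := by positivity
  linarith

theorem hiddenGain_antitone (hH : 1 ≤ H) (X : ℕ) : Antitone (hiddenGain H X) :=
    antitone_nat_of_succ_le fun x => by
  have := hiddenGain_succ hH X x
  have := decay_nonneg hH X x
  linarith

theorem hiddenGain_nonneg (hH : 1 ≤ H) (X x : ℕ) : 0 ≤ hiddenGain H X x := by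
  have := decay_nonneg hH X x
  unfold hiddenGain
  positivity

/-- For `h = 0` and `b = false` this marginal is exactly `hiddenGain H X x`, which is the source of
the indistinguishability. Once `w` is present, the summand `X - x` is lost, but a hidden element
keeps its full marginal. -/
theorem profile_succ_ordinary (hH : 1 ≤ H) (X x h : ℕ) (b : Bool) :
    profile H X (x + 1) h b - profile H X x h b =
      (H - h) * decay H X x + (if b then 0 else ((X - x : ℕ) : ℝ)) := by
  have h1 := hiddenGain_succ hH X x
  have h2 := lastGain_succ X x
  have h3 : hiddenGain H X x = decay H X x + hiddenGain H X (x + 1) := by linarith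
  unfold profile
  rw [h3]
  cases b <;> simp <;> linarith

theorem profile_succ_hidden (X x h : ℕ) (b : Bool) :
    profile H X x (h + 1) b - profile H X x h b = hiddenGain H X x := by
  unfold profile
  push_cast
  ring

theorem profile_last (X x h : ℕ) :
    profile H X x h true - profile H X x h false = lastGain X x := by
  unfold profile
  simp

/-- A single hidden element looks like an ordinary one. -/
theorem profile_one_hidden (hH : 1 ≤ H) (X x : ℕ) : profile H X x 1 false =
    profile H X (x + 1) 0 false := by
  have h1 := profile_succ_ordinary hH X x 0 false
  have h2 := profile_succ_hidden (H := H) X x 0 false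
  simp only [hiddenGain] at h2
  simp at h1 h2
  linarith

/-- The profile is a constant minus penalties with nonnegative factors that shrink as the set grows;
`h' ≤ H` keeps `H - h'` nonnegative. -/
theorem profile_mono (hH : 1 ≤ H) (X : ℕ) {x x' h h' : ℕ} {b b' : Bool} (hx : x ≤ x') (hh : h ≤ h')
    (hh' : h' ≤ H)
    (hb : b = true → b' = true) : profile H X x h b ≤ profile H X x' h' b' := by
  have h1 := hiddenGain_antitone hH X hx
  have h2 := lastGain_antitone X hx
  have h3 := hiddenGain_nonneg hH X x'
  have h4 := lastGain_nonneg X x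
  have h6 : (h : ℝ) ≤ h' := by exact_mod_cast hh
  have h7 : (h' : ℝ) ≤ H := by exact_mod_cast hh'
  have h8 : ((H : ℝ) - h') * hiddenGain H X x' ≤ (H - h) * hiddenGain H X x :=
    mul_le_mul (by linarith) h1 h3 (by linarith)
  unfold profile
  cases b <;> cases b' <;> simp_all <;> linarith

theorem profile_zero (X : ℕ) : profile H X 0 0 false = 0 := by
  simp [profile, topValue, hiddenGain, decay, lastGain]
  ring

theorem profile_all_hidden (X x : ℕ) : profile H X x H true = topValue H X := by
  simp [profile]

theorem profile_ordinary (X : ℕ) {x : ℕ} (hx : x ≤ X) :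
    profile H X x 0 true = X * (X + 1) / 2 + H * x := by
  have : x - X = 0 := by omega
  simp [profile, topValue, hiddenGain, decay, this]
  push_cast [hx]
  ring

end Profile

/-! ### The hard set function: submodularity, indistinguishability, extreme values. -/

section HardFunction

variable {E : Type*} [DecidableEq E]

/-- The hard function with hidden elements `O` and last element `w`. -/
noncomputable def hardFun (H X : ℕ) (O : Finset E) (w : E) (T : Finset E) : ℝ :=
  profile H X (T \ insert w O).card (T ∩ O).card (decide (w ∈ T))

variable {H : ℕ} {O : Finset E} {w : E}

theorem card_inter_le_of_card_le (hO : O.card ≤ H) (T : Finset E) : (T ∩ O).card ≤ H :=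
  (Finset.card_le_card Finset.inter_subset_right).trans hO

theorem hardFun_mono (hH : 1 ≤ H) (X : ℕ) (hO : O.card ≤ H) : IsMonotone (hardFun H X O w) :=
    fun S T hST =>
  profile_mono hH X (Finset.card_le_card (Finset.sdiff_subset_sdiff hST le_rfl))
    (Finset.card_le_card (Finset.inter_subset_inter_right hST)) (card_inter_le_of_card_le hO T)
    (by simpa using fun h => hST h)

theorem hardFun_empty (X : ℕ) : hardFun H X O w ∅ = 0 := by
  simpa [hardFun] using profile_zero X

theorem hardFun_nonneg (hH : 1 ≤ H) (X : ℕ) (hO : O.card ≤ H) (T : Finset E) :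
    0 ≤ hardFun H X O w T := by
  rw [← hardFun_empty (H := H) X (O := O) (w := w)]
  exact hardFun_mono hH X hO _ _ (Finset.empty_subset T)

theorem hardFun_le (hH : 1 ≤ H) (X : ℕ) (hO : O.card ≤ H) (T : Finset E) :
    hardFun H X O w T ≤ topValue H X := by
  rw [← profile_all_hidden (H := H) X (T \ insert w O).card]
  exact profile_mono hH X le_rfl (card_inter_le_of_card_le hO T) le_rfl (by simp)

/-- For each of the three kinds of elements, the marginal is an explicit expression that does not
increase when the counts grow or `w` is added. -/
theorem hardFun_submod (hH : 1 ≤ H) (X : ℕ) (hO : O.card ≤ H) (hw : w ∉ O) :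
    IsSubmodular (hardFun H X O w) := by
  intro S T hST e he
  have heS : e ∉ S := fun h => he (hST h)
  have hx : (S \ insert w O).card ≤ (T \ insert w O).card :=
    Finset.card_le_card (Finset.sdiff_subset_sdiff hST le_rfl)
  have hh : (S ∩ O).card ≤ (T ∩ O).card :=
    Finset.card_le_card (Finset.inter_subset_inter_right hST)
  have hhT := card_inter_le_of_card_le hO T
  unfold hardFun
  by_cases hew : e = w
  · subst hew
    have key : ∀ U : Finset E, e ∉ U → profile H X (insert e U \ insert e O).card
        (insert e U ∩ O).card (decide (e ∈ insert e U)) - profile H X (U \ insert e O).card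
        (U ∩ O).card (decide (e ∈ U)) = lastGain X (U \ insert e O).card := by
      intro U hU
      rw [Finset.insert_sdiff_of_mem _ (Finset.mem_insert_self _ _),
        Finset.insert_inter_of_notMem hw]
      simpa [hU] using profile_last X _ _
    rw [key S heS, key T he]
    exact lastGain_antitone X hx
  · have hwe : ∀ U : Finset E, decide (w ∈ insert e U) = decide (w ∈ U) := by
      intro U; simp [Ne.symm hew]
    rw [hwe, hwe]
    by_cases heO : e ∈ O
    · have key : ∀ U : Finset E, e ∉ U → profile H X (insert e U \ insert w O).card
          (insert e U ∩ O).card (decide (w ∈ U)) - profile H X (U \ insert w O).card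
          (U ∩ O).card (decide (w ∈ U)) = hiddenGain H X (U \ insert w O).card := by
        intro U hU
        rw [Finset.insert_sdiff_of_mem _ (Finset.mem_insert_of_mem heO),
          Finset.insert_inter_of_mem heO, Finset.card_insert_of_notMem (by simp [hU])]
        exact profile_succ_hidden X _ _ _
      rw [key S heS, key T he]
      exact hiddenGain_antitone hH X hx
    · have key : ∀ U : Finset E, e ∉ U → profile H X (insert e U \ insert w O).card
          (insert e U ∩ O).card (decide (w ∈ U)) - profile H X (U \ insert w O).card
          (U ∩ O).card (decide (w ∈ U)) =
            (H - (U ∩ O).card) * decay H X (U \ insert w O).card +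
              (if decide (w ∈ U) then 0 else ((X - (U \ insert w O).card : ℕ) : ℝ)) := by
        intro U hU
        rw [Finset.insert_sdiff_of_notMem _ (by simp [hew, heO]),
          Finset.insert_inter_of_notMem heO, Finset.card_insert_of_notMem (by simp [hU])]
        exact profile_succ_ordinary hH X _ _ _
      rw [key S heS, key T he]
      have h6 : ((S ∩ O).card : ℝ) ≤ (T ∩ O).card := by exact_mod_cast hh
      have h7 : ((T ∩ O).card : ℝ) ≤ H := by exact_mod_cast hhT
      refine add_le_add (mul_le_mul (by linarith) (decay_antitone hH X hx) (decay_nonneg hH X _)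
        (by linarith)) ?_
      -- The summand `X - x` is present only without `w`, and it is nonnegative, so adding `w` can
      -- only lower the marginal.
      by_cases hwS : w ∈ S
      · simp [hwS, hST hwS]
      · by_cases hwT : w ∈ T
        · simp [hwS, hwT]
        · simp only [hwS, hwT, decide_false, Bool.false_eq_true, if_false]
          exact_mod_cast Nat.sub_le_sub_left hx X

/-- Without a hidden element, the hidden set is not visible. -/
theorem hardFun_eq_of_disjoint (X : ℕ) {T : Finset E} (h : T ∩ O = ∅) :
    hardFun H X O w T = hardFun H X ∅ w T := by
  have : T \ insert w O = T \ insert w ∅ := by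
    ext u
    have : u ∈ T → u ∉ O := fun h1 h2 => by
      have : u ∈ T ∩ O := Finset.mem_inter.2 ⟨h1, h2⟩
      simp [h] at this
    simp
    tauto
  simp only [hardFun, this, h, Finset.inter_empty]

/-- Before the last element arrives, a single hidden element is not visible. -/
theorem hardFun_eq_of_card_le_one (hH : 1 ≤ H) (X : ℕ) {T : Finset E} (hwT : w ∉ T)
    (h : (T ∩ O).card ≤ 1) :
    hardFun H X O w T = hardFun H X ∅ w T := by
  rcases Nat.le_one_iff_eq_zero_or_eq_one.1 h with h0 | h1
  · exact hardFun_eq_of_disjoint X (Finset.card_eq_zero.1 h0)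
  · have e1 : T \ insert w O = T \ O := by
      ext u
      have : u ∈ T → u ≠ w := fun h1 h2 => hwT (h2 ▸ h1)
      simp
      tauto
    have e2 : T \ insert w ∅ = T := by
      ext u
      have : u ∈ T → u ≠ w := fun h1 h2 => hwT (h2 ▸ h1)
      simp
      tauto
    have e3 := Finset.card_sdiff_add_card_inter T O
    simp only [hardFun, e1, e2, hwT, decide_false, Finset.inter_empty, Finset.card_empty]
    rw [← e3, h1]
    exact profile_one_hidden hH X _

theorem hardFun_le_of_disjoint (hH : 1 ≤ H) (X : ℕ) {T : Finset E} (h : T ∩ O = ∅) {K : ℕ}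
    (hT : T.card ≤ K)
    (hK : K ≤ X) : hardFun H X O w T ≤ X * (X + 1) / 2 + H * K := by
  rw [← profile_ordinary X hK, hardFun, h, Finset.card_empty]
  exact profile_mono hH X ((Finset.card_le_card Finset.sdiff_subset).trans hT) le_rfl
    (Nat.zero_le _) (by simp)

theorem hardFun_optimum (X : ℕ) (hw : w ∉ O) (hcard : O.card = H) :
    hardFun H X O w (insert w O) = topValue H X := by
  rw [hardFun, Finset.insert_inter_of_notMem hw, Finset.inter_self, hcard]
  simpa using profile_all_hidden X _

end HardFunction

/-- The hard instance: the elements arrive in their natural order. -/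
noncomputable def hardInstance {N H : ℕ} (hH : 1 ≤ H) (X : ℕ) (O : Finset (Fin (N + 1)))
    (hO : O.card ≤ H) (hw : Fin.last N ∉ O) : StreamInstance (N + 1) where
  f := hardFun H X O (Fin.last N)
  nonneg := hardFun_nonneg hH X hO
  mono := hardFun_mono hH X hO
  submod := hardFun_submod hH X hO hw
  order := Equiv.refl _

/-! ### Runs of deterministic algorithms -/

namespace Algorithm

variable {n : ℕ} {W : Type*}

theorem state_succ (A : Algorithm n W) (I : StreamInstance n) {t : ℕ} (h : t < n) :
    A.state I (t + 1) =
      ((A.step (A.state I t).1 (A.state I t).2 (I.order ⟨t, h⟩) (fun T => I.f T.1)).1.1,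
        (A.step (A.state I t).1 (A.state I t).2 (I.order ⟨t, h⟩) (fun T => I.f T.1)).2) := by
  rw [state]
  simp [h]

theorem state_succ_subset (A : Algorithm n W) (I : StreamInstance n) {t : ℕ} (h : t < n) :
    (A.state I (t + 1)).1 ⊆ insert (I.order ⟨t, h⟩) (A.state I t).1 := by
  rw [state_succ A I h]
  exact (A.step (A.state I t).1 (A.state I t).2 (I.order ⟨t, h⟩) (fun T => I.f T.1)).1.2

theorem output_subset (A : Algorithm n W) (I : StreamInstance n) :
    A.output I ⊆ (A.state I n).1 :=
  (A.out (A.state I n).1 (A.state I n).2 (fun T => I.f T.1)).2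

theorem card_state_le_space (A : Algorithm n W) (I : StreamInstance n) {t : ℕ} (ht : t ≤ n) :
    (A.state I t).1.card ≤ A.space I :=
  (Finset.le_sup (f := fun t => (A.state I t).1.card)
    (Finset.mem_range.2 (Nat.lt_succ_of_le ht))).trans (Nat.le_add_left _ _)

/-- Two inputs are not told apart if they agree on all sets that are queried on one of them. -/
theorem state_eq_of_agree (A : Algorithm n W) (I J : StreamInstance n) (horder : J.order = I.order)
    (h : ∀ t (ht : t < n), ∀ T ⊆ insert (I.order ⟨t, ht⟩) (A.state I t).1, J.f T = I.f T)
    {t : ℕ} (ht : t ≤ n) : A.state J t = A.state I t := by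
  induction t with
  | zero => rfl
  | succ t ih =>
    have htn : t < n := ht
    have ih := ih htn.le
    rw [state_succ A J htn, state_succ A I htn, ih, horder]
    have : (fun T : {T : Finset (Fin n) // T ⊆ insert (I.order ⟨t, htn⟩) (A.state I t).1} =>
        J.f T.1) = fun T => I.f T.1 := funext fun T => h t htn T.1 T.2
    rw [this]

theorem output_eq_of_agree (A : Algorithm n W) (I J : StreamInstance n)
    (horder : J.order = I.order)
    (h : ∀ t (ht : t < n), ∀ T ⊆ insert (I.order ⟨t, ht⟩) (A.state I t).1, J.f T = I.f T)
    (hout : ∀ T ⊆ (A.state I n).1, J.f T = I.f T) : A.output J = A.output I := by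
  unfold output
  rw [state_eq_of_agree A I J horder h le_rfl]
  have : (fun T : {T : Finset (Fin n) // T ⊆ (A.state I n).1} => J.f T.1) = fun T => I.f T.1 :=
    funext fun T => hout T.1 T.2
  rw [this]

/-- In a stream in natural order, the stored elements have arrived already. -/
theorem val_lt_of_mem_state (A : Algorithm n W) (I : StreamInstance n)
    (horder : I.order = Equiv.refl _) {t : ℕ} (ht : t ≤ n) {u : Fin n}
    (hu : u ∈ (A.state I t).1) : u.val < t := by
  induction t with
  | zero => simp [state] at hu
  | succ t ih =>
    have := state_succ_subset A I (t := t) ht hu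
    rw [horder, Finset.mem_insert] at this
    rcases this with rfl | h
    · simp
    · exact (ih (by omega) h).trans (Nat.lt_succ_self t)

/-- In a stream in natural order, an element stored now was stored ever since it arrived. -/
theorem mem_state_of_mem_state (A : Algorithm n W) (I : StreamInstance n)
    (horder : I.order = Equiv.refl _) {t t' : ℕ} (ht : t ≤ n) {u : Fin n}
    (hu : u ∈ (A.state I t).1) (hut : u.val < t') (htt : t' ≤ t) : u ∈ (A.state I t').1 := by
  induction t with
  | zero => simp [state] at hu
  | succ t ih =>
    rcases Nat.lt_or_ge t t' with h | h
    · rwa [show t' = t + 1 by omega]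
    · have := state_succ_subset A I (t := t) ht hu
      rw [horder, Finset.mem_insert] at this
      rcases this with rfl | h'
      · simp at hut; omega
      · exact ih (by omega) h' h

end Algorithm

/-! ### Runs on the hard instances -/

section Blind

variable {N H : ℕ} {W : Type*}

/-- If the run on the instance without hidden elements never has two elements of `O` at hand, and
stores none of them when the last element arrives, then the run on the instance with hidden
elements `O` is the same, and the output misses `O`. -/
theorem output_inter_hidden_eq_empty (A : Algorithm (N + 1) W) (hH : 1 ≤ H) (X : ℕ)
    {O : Finset (Fin (N + 1))} (hO : O.card ≤ H) (hw : Fin.last N ∉ O)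
    {I : StreamInstance (N + 1)} (hI : I = hardInstance hH X ∅ (Nat.zero_le _) (by simp))
    (hpair : ∀ v ∈ O, ∀ u ∈ O, u ∉ (A.state I v.val).1)
    (hlast : ∀ u ∈ O, u ∉ (A.state I N).1) :
    A.output (hardInstance hH X O hO hw) ∩ O = ∅ := by
  have horder : I.order = Equiv.refl _ := by rw [hI]; rfl
  have hf : I.f = hardFun H X ∅ (Fin.last N) := by rw [hI]; rfl
  -- Covers both the queries made on the arrival of `w` and those made for the final output.
  have hend : ∀ T ⊆ insert (Fin.last N) (A.state I N).1, T ∩ O = ∅ := by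
    intro T hT
    refine Finset.eq_empty_of_forall_notMem fun u hu => ?_
    rw [Finset.mem_inter] at hu
    rcases Finset.mem_insert.1 (hT hu.1) with rfl | h
    · exact hw hu.2
    · exact hlast u hu.2 h
  have hfinal : (A.state I (N + 1)).1 ⊆ insert (Fin.last N) (A.state I N).1 := by
    have := A.state_succ_subset I (t := N) (by omega)
    rwa [horder] at this
  have heq : A.output (hardInstance hH X O hO hw) = A.output I := by
    refine A.output_eq_of_agree I _ (by rw [horder]; rfl) (fun t ht T hT => ?_) fun T hT => ?_
    · rw [horder, Equiv.refl_apply] at hT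
      rw [hf]
      rcases Nat.lt_or_ge t N with htN | htN
      · refine hardFun_eq_of_card_le_one hH X (fun hwT => ?_) ?_
        · rcases Finset.mem_insert.1 (hT hwT) with h | h
          · have := congrArg Fin.val h
            simp at this
            omega
          · have := A.val_lt_of_mem_state I horder ht.le h
            simp at this
            omega
        -- Of two hidden elements at hand, the earlier one was already stored when the later one
        -- arrived, which `hpair` excludes.
        · have key : ∀ u ∈ T ∩ O, ∀ v ∈ T ∩ O, ¬ u < v := by
            intro u hu v hv huv
            rw [Finset.mem_inter] at hu hv
            have hvt : v.val ≤ t := by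
              rcases Finset.mem_insert.1 (hT hv.1) with rfl | h
              · exact le_rfl
              · exact (A.val_lt_of_mem_state I horder ht.le h).le
            have hut : u ∈ (A.state I t).1 := by
              rcases Finset.mem_insert.1 (hT hu.1) with rfl | h
              · exact absurd (Fin.lt_def.1 huv) (by simpa using hvt)
              · exact h
            exact hpair v hv.2 u hu.2 (A.mem_state_of_mem_state I horder ht.le hut huv hvt)
          refine Finset.card_le_one.2 fun u hu v hv => ?_
          exact le_antisymm (not_lt.1 (key v hv u hu)) (not_lt.1 (key u hu v hv))
      · obtain rfl : t = N := by omega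
        exact hardFun_eq_of_disjoint X (hend T hT)
    · rw [hf]
      exact hardFun_eq_of_disjoint X (hend T (hT.trans hfinal))
  rw [heq]
  exact hend _ ((A.output_subset I).trans hfinal)

end Blind

/-! ### Random transversals -/

section Transversal

variable {H m : ℕ} {E : Type*} [DecidableEq E]

/-- The set that contains the `φ i`-th element of the `i`-th block, for each `i`. -/
def transversal (ι : Fin H × Fin m → E) (φ : Fin H → Fin m) : Finset E :=
  Finset.univ.image fun i => ι (i, φ i)

theorem mem_transversal {ι : Fin H × Fin m → E} {φ : Fin H → Fin m} {u : E} :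
    u ∈ transversal ι φ ↔ ∃ i, ι (i, φ i) = u := by
  simp [transversal]

theorem card_transversal {ι : Fin H × Fin m → E} (hι : Function.Injective ι) (φ : Fin H → Fin m) :
    (transversal ι φ).card = H := by
  rw [transversal, Finset.card_image_of_injective _ fun i j h => (Prod.ext_iff.1 (hι h)).1]
  simp

theorem card_filter_apply_eq_mul (i : Fin H) (a : Fin m) :
    (Finset.univ.filter fun φ : Fin H → Fin m => φ i = a).card * m = m ^ H := by
  -- The choice functions with a prescribed value form a box with one side reduced to a point, so
  -- the count is a product.
  have h : (Finset.univ.filter fun φ : Fin H → Fin m => φ i = a) =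
      Fintype.piFinset
        (Function.update (fun _ => (Finset.univ : Finset (Fin m))) i ({a} : Finset (Fin m))) := by
    ext φ
    simp only [Finset.mem_filter, Finset.mem_univ, true_and, Fintype.mem_piFinset]
    constructor
    · intro h k
      by_cases hk : k = i
      · subst hk; simp [h]
      · simp [hk]
    · intro h; simpa using h i
  have h2 : ∀ k, (Function.update (fun _ : Fin H => (Finset.univ : Finset (Fin m)))
      i ({a} : Finset (Fin m)) k).card =
      Function.update (fun _ => m) i 1 k := by
    intro k
    by_cases hk : k = i
    · subst hk; simp
    · simp [hk]
  rw [h, Fintype.card_piFinset, Finset.prod_congr rfl fun k _ => h2 k,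
    Finset.prod_update_of_mem (Finset.mem_univ i), one_mul, Finset.prod_const,
    Finset.card_sdiff_of_subset (by simp)]
  simp only [Finset.card_univ, Fintype.card_fin, Finset.card_singleton]
  rw [← pow_succ, Nat.sub_add_cancel (Fin.pos i)]

theorem card_filter_apply_eq_and_mul {i j : Fin H} (hij : i ≠ j) (a b : Fin m) :
    (Finset.univ.filter fun φ : Fin H → Fin m => φ i = a ∧ φ j = b).card * m ^ 2 = m ^ H := by
  have h : (Finset.univ.filter fun φ : Fin H → Fin m => φ i = a ∧ φ j = b) =
      Fintype.piFinset
        (Function.update (Function.update (fun _ => (Finset.univ : Finset (Fin m)))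
          j ({b} : Finset (Fin m))) i ({a} : Finset (Fin m))) := by
    ext φ
    simp only [Finset.mem_filter, Finset.mem_univ, true_and, Fintype.mem_piFinset]
    constructor
    · intro h k
      by_cases hk : k = i
      · subst hk; simp [h]
      · by_cases hk' : k = j
        · subst hk'; simp [hk, h]
        · simp [hk, hk']
    · intro h
      have hi := h i
      have hj := h j
      simp [hij.symm] at hi hj
      exact ⟨hi, hj⟩
  have h2 : ∀ k, (Function.update (Function.update
      (fun _ : Fin H => (Finset.univ : Finset (Fin m)))
        j ({b} : Finset (Fin m))) i ({a} : Finset (Fin m)) k).card =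
      Function.update (Function.update (fun _ => m) j 1) i 1 k := by
    intro k
    by_cases hk : k = i
    · subst hk; simp
    · by_cases hk' : k = j
      · subst hk'; simp [hk]
      · simp [hk, hk']
  rw [h, Fintype.card_piFinset, Finset.prod_congr rfl fun k _ => h2 k,
    Finset.prod_update_of_mem (Finset.mem_univ i), one_mul,
    Finset.prod_update_of_mem (by simp [hij.symm]), one_mul, Finset.prod_const]
  have h3 : ((Finset.univ \ {i}) \ {j} : Finset (Fin H)).card + 2 = H := by
    have h4 : 2 ≤ H := by
      have := Finset.card_le_univ ({i, j} : Finset (Fin H))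
      rwa [Finset.card_pair hij, Fintype.card_fin] at this
    rw [Finset.card_sdiff_of_subset (by simp [hij.symm]), Finset.card_sdiff_of_subset (by simp)]
    simp only [Finset.card_univ, Fintype.card_fin, Finset.card_singleton]
    omega
  rw [← pow_add, h3]

/-- An element is in a random transversal with probability at most `1 / m`. -/
theorem card_filter_mem_transversal_mul_le {ι : Fin H × Fin m → E} (hι : Function.Injective ι)
    (u : E) : (Finset.univ.filter fun φ => u ∈ transversal ι φ).card * m ≤ m ^ H := by
  by_cases hu : ∃ p, ι p = u
  · obtain ⟨⟨i, a⟩, rfl⟩ := hu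
    rw [← card_filter_apply_eq_mul i a]
    refine Nat.mul_le_mul_right _ (Finset.card_le_card fun φ hφ => ?_)
    simp only [Finset.mem_filter, Finset.mem_univ, true_and, mem_transversal] at hφ ⊢
    obtain ⟨k, hk⟩ := hφ
    obtain ⟨rfl, h⟩ := Prod.ext_iff.1 (hι hk)
    exact h
  · rw [Finset.filter_false_of_mem]
    · simp
    · intro φ _ h
      obtain ⟨i, hi⟩ := mem_transversal.1 h
      exact hu ⟨_, hi⟩

/-- Two elements are in a random transversal with probability at most `1 / m ^ 2`. -/
theorem card_filter_mem_and_mem_transversal_mul_le {ι : Fin H × Fin m → E}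
    (hι : Function.Injective ι) {u v : E} (huv : u ≠ v) :
    (Finset.univ.filter fun φ => u ∈ transversal ι φ ∧ v ∈ transversal ι φ).card * m ^ 2 ≤
      m ^ H := by
  -- Only elements of two different blocks can lie in a common transversal; otherwise the count is
  -- zero.
  by_cases hu : ∃ i a j b, i ≠ j ∧ ι (i, a) = u ∧ ι (j, b) = v
  · obtain ⟨i, a, j, b, hij, rfl, rfl⟩ := hu
    rw [← card_filter_apply_eq_and_mul hij a b]
    refine Nat.mul_le_mul_right _ (Finset.card_le_card fun φ hφ => ?_)
    simp only [Finset.mem_filter, Finset.mem_univ, true_and, mem_transversal] at hφ ⊢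
    obtain ⟨⟨k, hk⟩, l, hl⟩ := hφ
    obtain ⟨rfl, h⟩ := Prod.ext_iff.1 (hι hk)
    obtain ⟨rfl, h'⟩ := Prod.ext_iff.1 (hι hl)
    exact ⟨h, h'⟩
  · rw [Finset.filter_false_of_mem]
    · simp
    · rintro φ _ ⟨h, h'⟩
      obtain ⟨i, rfl⟩ := mem_transversal.1 h
      obtain ⟨j, rfl⟩ := mem_transversal.1 h'
      exact hu ⟨i, _, j, _, fun hij => huv (by rw [hij]), rfl, rfl⟩

end Transversal

/-! ### The average over the hard instances -/

section Average

variable {N H m : ℕ} {W : Type*}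

/-- The hidden sets that a run on the instance without hidden elements may come across. -/
noncomputable def detected (A : Algorithm (N + 1) W) (I : StreamInstance (N + 1))
    (ι : Fin H × Fin m → Fin (N + 1)) : Finset (Fin H → Fin m) :=
  (Finset.univ.biUnion fun v : Fin (N + 1) => (A.state I v.val).1.biUnion fun u =>
      Finset.univ.filter fun φ => u ∈ transversal ι φ ∧ v ∈ transversal ι φ) ∪
    (A.state I N).1.biUnion fun u => Finset.univ.filter fun φ => u ∈ transversal ι φ

/-- Union bound: at most `s` stored partners `u` for each of the `N + 1` arrivals `v`, each pair
having frequency at most `1/m²`, and at most `s` elements stored before the last arrival, each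
having frequency at most `1/m`. -/
theorem card_detected_mul_le (A : Algorithm (N + 1) W) {I : StreamInstance (N + 1)}
    (horder : I.order = Equiv.refl _) {ι : Fin H × Fin m → Fin (N + 1)}
    (hι : Function.Injective ι) {s : ℕ} (hs : A.space I ≤ s) :
    (detected A I ι).card * m ^ 2 ≤ (s * (N + 1) + s * m) * m ^ H := by
  have hcard : ∀ t, t ≤ N + 1 → (A.state I t).1.card ≤ s := fun t ht =>
    (A.card_state_le_space I ht).trans hs
  have h1 : (Finset.univ.biUnion fun v : Fin (N + 1) => (A.state I v.val).1.biUnion fun u =>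
      Finset.univ.filter fun φ => u ∈ transversal ι φ ∧ v ∈ transversal ι φ).card * m ^ 2 ≤
      (N + 1) * (s * m ^ H) := by
    refine (Nat.mul_le_mul_right _ Finset.card_biUnion_le).trans ?_
    rw [Finset.sum_mul]
    refine (Finset.sum_le_card_nsmul _ _ (s * m ^ H) fun v _ => ?_).trans (by simp)
    refine (Nat.mul_le_mul_right _ Finset.card_biUnion_le).trans ?_
    rw [Finset.sum_mul]
    refine (Finset.sum_le_card_nsmul _ _ (m ^ H) fun u hu => ?_).trans ?_
    · have := A.val_lt_of_mem_state I horder v.is_lt.le hu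
      exact card_filter_mem_and_mem_transversal_mul_le hι (Fin.ne_of_lt this)
    · rw [smul_eq_mul]
      exact Nat.mul_le_mul_right _ (hcard _ v.is_lt.le)
  have h2 : ((A.state I N).1.biUnion fun u =>
      Finset.univ.filter fun φ => u ∈ transversal ι φ).card * m ≤ s * m ^ H := by
    refine (Nat.mul_le_mul_right _ Finset.card_biUnion_le).trans ?_
    rw [Finset.sum_mul]
    refine (Finset.sum_le_card_nsmul _ _ (m ^ H) fun u _ =>
      card_filter_mem_transversal_mul_le hι u).trans ?_
    rw [smul_eq_mul]
    exact Nat.mul_le_mul_right _ (hcard _ (Nat.le_succ N))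
  calc (detected A I ι).card * m ^ 2
      ≤ _ := Nat.mul_le_mul_right _ (Finset.card_union_le _ _)
    _ ≤ (N + 1) * (s * m ^ H) + s * m ^ H * m := by
        rw [add_mul]
        refine add_le_add h1 ?_
        rw [sq, ← mul_assoc]
        exact Nat.mul_le_mul_right _ h2
    _ = _ := by ring

/-- The hard instance whose hidden set is a transversal. -/
noncomputable def transversalInstance (hH : 1 ≤ H) (X : ℕ) {ι : Fin H × Fin m → Fin (N + 1)}
    (hι : Function.Injective ι) (hlast : ∀ p, ι p ≠ Fin.last N) (φ : Fin H → Fin m) :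
    StreamInstance (N + 1) :=
  hardInstance hH X (transversal ι φ) (card_transversal hι φ).le fun h => by
    obtain ⟨i, hi⟩ := mem_transversal.1 h
    exact hlast _ hi

/-- An undetected transversal is missed by the output, which then has only the blind value; for a
detected one the bound is the trivial `topValue`. -/
theorem sum_output_le (A : Algorithm (N + 1) W) (hH : 1 ≤ H) (X : ℕ)
    {ι : Fin H × Fin m → Fin (N + 1)} (hι : Function.Injective ι)
    (hlast : ∀ p, ι p ≠ Fin.last N) {I : StreamInstance (N + 1)}
    (hI : I = hardInstance hH X ∅ (Nat.zero_le _) (by simp)) {K : ℕ} (hK : K ≤ X)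
    (hout : ∀ φ, (A.output (transversalInstance hH X hι hlast φ)).card ≤ K) :
    ∑ φ, (transversalInstance hH X hι hlast φ).f (A.output (transversalInstance hH X hι hlast φ)) ≤
      m ^ H * ((X * (X + 1) / 2 + H * K : ℝ)) + (detected A I ι).card * topValue H X := by
  have hterm : ∀ φ, (transversalInstance hH X hι hlast φ).f
      (A.output (transversalInstance hH X hι hlast φ)) ≤
      (X * (X + 1) / 2 + H * K : ℝ) + if φ ∈ detected A I ι then topValue H X else 0 := by
    intro φ
    by_cases hφ : φ ∈ detected A I ι
    · rw [if_pos hφ]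
      have h1 := hardFun_le hH X (card_transversal hι φ).le (w := Fin.last N)
        (A.output (transversalInstance hH X hι hlast φ))
      have h2 : (0 : ℝ) ≤ X * (X + 1) / 2 + H * K := by positivity
      exact h1.trans (by linarith)
    · rw [if_neg hφ, add_zero]
      simp only [detected, Finset.mem_union, Finset.mem_biUnion, Finset.mem_filter,
        Finset.mem_univ, true_and, not_or, not_exists, not_and] at hφ
      refine hardFun_le_of_disjoint hH X ?_ (hout φ) hK
      exact output_inter_hidden_eq_empty A hH X _ _ hI
        (fun v hv u hu hmem => hφ.1 v u hmem hu hv) fun u hu hmem => hφ.2 u hmem hu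
  refine (Finset.sum_le_sum fun φ _ => hterm φ).trans (le_of_eq ?_)
  rw [Finset.sum_add_distrib, Finset.sum_const, Finset.sum_ite_mem, Finset.sum_const]
  simp [mul_add]

/-! ### Expectation over the random seed. -/

namespace RandomizedAlgorithm

variable {Ω : Type*} [MeasurableSpace Ω]

theorem integrable_output {n : ℕ} (A : RandomizedAlgorithm n W Ω) (I : StreamInstance n) :
    Integrable (fun ω => I.f ((A.alg ω).output I)) A.law := by
  have := A.isProb
  -- The output takes finitely many values, so the discrete σ-algebra suffices and boundedness
  -- follows from monotonicity.
  let _ : MeasurableSpace (Finset (Fin n)) := ⊤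
  have hmeas : Measurable fun ω => (A.alg ω).output I :=
    measurable_to_countable' fun O => A.measurable_output I O
  refine Integrable.of_bound ((measurable_from_top (f := I.f)).comp hmeas).aestronglyMeasurable
    (I.f Finset.univ) (Filter.Eventually.of_forall fun ω => ?_)
  rw [Real.norm_of_nonneg (I.nonneg _)]
  exact I.mono _ _ (Finset.subset_univ _)

/-- An algorithm whose ratio on the hard instances exceeds `β` stores many elements. -/
theorem ratio_sub_mul_le (A : RandomizedAlgorithm (N + 1) W Ω) (hH : 1 ≤ H) (X : ℕ)
    (hX : H + 1 ≤ X) (hm : 1 ≤ m) (hmN : H * m ≤ N) {α β : ℝ} (hA : A.HasApproxRatio (H + 1) α)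
    {s : ℕ} (hs : A.UsesSpaceAtMost s)
    (hβ : (X * (X + 1) / 2 + H * (H + 1) : ℝ) ≤ β * topValue H X) :
    (α - β) * (m : ℝ) ^ 2 ≤ s * (N + 1) + s * m := by
  have := A.isProb
  obtain ⟨e⟩ : Nonempty (Fin H × Fin m ↪ Fin N) :=
    -- The blocks are placed among the first `N` elements, which keeps the last one out of every
    -- transversal.
    Function.Embedding.nonempty_of_card_le (by simpa using hmN)
  let ι : Fin H × Fin m → Fin (N + 1) := fun p => (e p).castSucc
  have hι : Function.Injective ι := (Fin.castSucc_injective N).comp e.injective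
  have hlast : ∀ p, ι p ≠ Fin.last N := fun p => Fin.castSucc_ne_last _
  let J := transversalInstance hH X hι hlast
  let I : StreamInstance (N + 1) := hardInstance hH X ∅ (Nat.zero_le _) (by simp)
  have hP : 0 < topValue H X := by
    have : (0 : ℝ) < H := by exact_mod_cast hH
    unfold topValue
    positivity
  have hm0 : (0 : ℝ) < m := by exact_mod_cast hm
  have hM : (0 : ℝ) < (m : ℝ) ^ H := by positivity
  have hlow : ∀ φ, α * topValue H X ≤ ∫ ω, (J φ).f ((A.alg ω).output (J φ)) ∂A.law := by
    intro φ
    have hw : Fin.last N ∉ transversal ι φ := fun h => by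
      obtain ⟨i, hi⟩ := mem_transversal.1 h
      exact hlast _ hi
    have h := (hA (J φ)).2 (insert (Fin.last N) (transversal ι φ))
      (by rw [Finset.card_insert_of_notMem hw, card_transversal hι])
    rwa [show (J φ).f (insert (Fin.last N) (transversal ι φ)) = topValue H X from
      hardFun_optimum X hw (card_transversal hι φ)] at h
  have hsum : (m : ℝ) ^ H * (α * topValue H X) ≤
      ∫ ω, ∑ φ, (J φ).f ((A.alg ω).output (J φ)) ∂A.law := by
    rw [integral_finsetSum _ fun φ _ => A.integrable_output (J φ)]
    refine le_trans (le_of_eq ?_) (Finset.sum_le_sum fun φ _ => hlow φ)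
    rw [Finset.sum_const]
    simp
  have hup : ∀ᵐ ω ∂A.law, ∑ φ, (J φ).f ((A.alg ω).output (J φ)) ≤
      (m : ℝ) ^ H * (β * topValue H X) +
        (s * (N + 1) + s * m) * (m : ℝ) ^ H / (m : ℝ) ^ 2 * topValue H X := by
    have hfeas : ∀ᵐ ω ∂A.law, ∀ φ, ((A.alg ω).output (J φ)).card ≤ H + 1 :=
      ae_all_iff.2 fun φ => (hA (J φ)).1
    filter_upwards [hfeas, hs I] with ω h1 h2
    refine (sum_output_le (A.alg ω) hH X hι hlast (I := I) rfl hX h1).trans ?_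
    have h3 := card_detected_mul_le (A.alg ω) (I := I) rfl hι h2
    have h4 : ((detected (A.alg ω) I ι).card : ℝ) * (m : ℝ) ^ 2 ≤
        (s * (N + 1) + s * m) * (m : ℝ) ^ H := by exact_mod_cast h3
    have h5 := (le_div_iff₀ (by positivity)).2 h4
    refine add_le_add (mul_le_mul_of_nonneg_left ?_ hM.le)
      (mul_le_mul_of_nonneg_right h5 hP.le)
    push_cast
    exact hβ
  have hint : ∫ ω, ∑ φ, (J φ).f ((A.alg ω).output (J φ)) ∂A.law ≤
      (m : ℝ) ^ H * (β * topValue H X) +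
        (s * (N + 1) + s * m) * (m : ℝ) ^ H / (m : ℝ) ^ 2 * topValue H X := by
    refine (integral_mono_ae (integrable_finsetSum _ fun φ _ => A.integrable_output (J φ))
      (integrable_const _) hup).trans (le_of_eq ?_)
    simp
  have h6 := hsum.trans hint
  have h7 : ((m : ℝ) ^ H * topValue H X) * (α - β) ≤
      ((m : ℝ) ^ H * topValue H X) * ((s * (N + 1) + s * m) / (m : ℝ) ^ 2) := by
    have : (s * (N + 1) + s * m) * (m : ℝ) ^ H / (m : ℝ) ^ 2 * topValue H X =
      ((m : ℝ) ^ H * topValue H X) * ((s * (N + 1) + s * m) / (m : ℝ) ^ 2) := by ring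
    linarith
  have h8 := le_of_mul_le_mul_left h7 (by positivity)
  exact (le_div_iff₀ (by positivity)).1 h8

/-- Without space, no positive ratio is achieved. -/
theorem one_le_space (A : RandomizedAlgorithm (N + 1) W Ω) {K : ℕ} (hK : 1 ≤ K) {α : ℝ}
    (hα : 0 < α) (hA : A.HasApproxRatio K α) {s : ℕ} (hs : A.UsesSpaceAtMost s) : 1 ≤ s := by
  by_contra h
  obtain rfl : s = 0 := by omega
  let I : StreamInstance (N + 1) :=
    hardInstance (H := 1) le_rfl 1 ∅ (Nat.zero_le _) (by simp)
  have h1 := (hA I).2 {Fin.last N} (by simpa using hK)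
  have h2 : I.f {Fin.last N} = 1 := by
    change hardFun 1 1 ∅ (Fin.last N) {Fin.last N} = 1
    simp [hardFun, profile_ordinary]
  have h3 : ∫ ω, I.f ((A.alg ω).output I) ∂A.law = 0 := by
    refine integral_eq_zero_of_ae ?_
    filter_upwards [hs I] with ω hω
    have h4 := ((A.alg ω).card_state_le_space I le_rfl).trans hω
    have h5 := (A.alg ω).output_subset I
    rw [Finset.card_eq_zero.1 (Nat.le_zero.1 h4), Finset.subset_empty] at h5
    rw [h5]
    exact hardFun_empty 1
  rw [h2, h3] at h1
  linarith

end RandomizedAlgorithm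

end Average

/-! ### The choice of the parameters -/

theorem ratio_eq : 2 / (2 + Real.sqrt 2) = 2 - Real.sqrt 2 := by
  have h : Real.sqrt 2 * Real.sqrt 2 = 2 := Real.mul_self_sqrt (by norm_num)
  have : 0 ≤ Real.sqrt 2 := Real.sqrt_nonneg 2
  rw [div_eq_iff (by positivity)]
  linarith

/-- At `X = √2 H` the leading terms on both sides agree for the ratio `2 - √2`. Rounding `X` up and
the lower-order terms cost at most `6H`, which `ε/2 * H²` absorbs when `H ≥ 12/ε`. -/
theorem blind_value_le {ε : ℝ} (hε : 0 < ε) {H X : ℕ} (hH : 12 / ε ≤ H) (hH1 : 1 ≤ H)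
    (hX : Real.sqrt 2 * H ≤ X) (hX' : (X : ℝ) ≤ Real.sqrt 2 * H + 1) :
    (X * (X + 1) / 2 + H * (H + 1) : ℝ) ≤ (2 / (2 + Real.sqrt 2) + ε / 2) * topValue H X := by
  rw [ratio_eq]
  set q := Real.sqrt 2 with hq
  have hqq : q * q = 2 := Real.mul_self_sqrt (by norm_num)
  have hq1 : 1 ≤ q := Real.one_le_sqrt.2 (by norm_num)
  have hq2 : q ≤ 3 / 2 := by nlinarith
  have hH1' : (1 : ℝ) ≤ H := by exact_mod_cast hH1
  set x : ℝ := (X : ℝ)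
  set y : ℝ := (H : ℝ)
  have hεy : 12 ≤ ε * y := by rwa [div_le_iff₀' hε] at hH
  have hP : y ^ 2 ≤ topValue H X := by
    have : (0 : ℝ) ≤ x := Nat.cast_nonneg X
    unfold topValue
    nlinarith [mul_nonneg this (by linarith : (0 : ℝ) ≤ y)]
  have h1 : ε / 2 * y ^ 2 ≤ ε / 2 * topValue H X := mul_le_mul_of_nonneg_left hP (by linarith)
  have h2 : 6 * y ≤ ε / 2 * y ^ 2 := by nlinarith
  have h3 : x * (x + 1) ≤ (q * y + 1) * (q * y + 2) := by
    have : (0 : ℝ) ≤ x := Nat.cast_nonneg X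
    nlinarith
  have h4 : (q * y + 1) * (q * y + 2) = 2 * y ^ 2 + 3 * (q * y) + 2 := by
    linear_combination y ^ 2 * hqq
  have h5 : (q - 1) * (x * (x + 1)) ≤ (q - 1) * (2 * y ^ 2 + 3 * (q * y) + 2) :=
    mul_le_mul_of_nonneg_left (h3.trans h4.le) (by linarith)
  have h6 : (2 - q) * y * (q * y) ≤ (2 - q) * y * x :=
    mul_le_mul_of_nonneg_left hX (mul_nonneg (by linarith) (by linarith))
  have h7 : (q - 1) * (3 * (q * y) + 2) ≤ 10 * y := by
    have : 3 * (q * y) + 2 ≤ 20 * y := by nlinarith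
    nlinarith
  have h8 : (2 - q) * y * (q * y) = 2 * (q - 1) * y ^ 2 := by
    linear_combination (-y ^ 2) * hqq
  have h9 : topValue H X = y ^ 2 + y * x + x * (x + 1) / 2 := rfl
  have h10 : (2 - q + ε / 2) * topValue H X =
      (2 - q) * (y ^ 2 + y * x + x * (x + 1) / 2) + ε / 2 * topValue H X := by
    rw [← h9]; ring
  rw [h10]
  linarith

end ElementStore

theorem theorem1 (ε : ℝ) (hε : 0 < ε) :
    ∃ c : ℝ, 0 < c ∧ ∃ K₀ : ℕ, ∀ K : ℕ, K₀ ≤ K →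
      ∀ (n : ℕ) (W : Type*) (Ω : Type*) [MeasurableSpace Ω]
        (A : ElementStore.RandomizedAlgorithm n W Ω),
        A.HasApproxRatio K (2 / (2 + Real.sqrt 2) + ε) →
        ∀ s : ℕ, A.UsesSpaceAtMost s → c * ((n : ℝ) / (K : ℝ) ^ 2) ≤ (s : ℝ) := by
  -- `ε/16` serves large `n` and `1/2` serves `n < 2K`. The threshold yields `H ≥ 12/ε` and `H ≥ 3`.
  refine ⟨min (ε / 16) (1 / 2), by positivity, ⌈12 / ε⌉₊ + 4, fun K hK n W Ω _ A hA s hs => ?_⟩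
  obtain ⟨H, rfl⟩ : ∃ H, K = H + 1 := ⟨K - 1, by omega⟩
  rcases n with _ | N
  · simp
  have hH3 : 3 ≤ H := by omega
  have hHε : 12 / ε ≤ H := (Nat.le_ceil _).trans (by exact_mod_cast (by omega))
  have hK0 : (0 : ℝ) < (H + 1 : ℕ) := by positivity
  rw [mul_div_assoc', div_le_iff₀ (by positivity)]
  -- For `n < 2K` the claimed bound is at most 1, so it is enough that some space is used; otherwise
  -- the blocks are nonempty.
  rcases Nat.lt_or_ge (N + 1) (2 * (H + 1)) with hn | hn
  · have h1 : (1 : ℝ) ≤ s := by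
      exact_mod_cast A.one_le_space (by omega) (by positivity) hA hs
    have h2 : ((N + 1 : ℕ) : ℝ) ≤ 2 * (H + 1 : ℕ) := by exact_mod_cast hn.le
    have h3 : min (ε / 16) (1 / 2) * ((N + 1 : ℕ) : ℝ) ≤ 1 / 2 * (2 * (H + 1 : ℕ)) :=
      mul_le_mul (min_le_right _ _) h2 (by positivity) (by norm_num)
    have h4 : (1 : ℝ) ≤ (H + 1 : ℕ) := by exact_mod_cast (by omega)
    nlinarith
  · have hq1 : (4 / 3 : ℝ) ≤ Real.sqrt 2 := Real.le_sqrt_of_sq_le (by norm_num)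
    have hH3' : (3 : ℝ) ≤ H := by exact_mod_cast hH3
    have hX1 := Nat.le_ceil (Real.sqrt 2 * H)
    have hX2 := (Nat.ceil_lt_add_one (by positivity : 0 ≤ Real.sqrt 2 * H)).le
    -- Here `H ≥ 3` enters: `4/3 * H ≥ H + 1`.
    have hXH : H + 1 ≤ ⌈Real.sqrt 2 * H⌉₊ := by
      have : ((H + 1 : ℕ) : ℝ) ≤ ⌈Real.sqrt 2 * H⌉₊ := by push_cast; nlinarith
      exact_mod_cast this
    obtain ⟨m, hm⟩ : ∃ m, m = N / H := ⟨_, rfl⟩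
    have hmN : H * m ≤ N := hm ▸ Nat.mul_div_le N H
    have hm1 : 1 ≤ m := by
      rw [hm, Nat.le_div_iff_mul_le (by omega)]
      omega
    have hlt : N < H * m + H := by
      have := Nat.lt_mul_div_succ N (show 0 < H by omega)
      rw [← hm] at this
      linarith
    have hmle : m ≤ N + 1 := by nlinarith
    have hmain := A.ratio_sub_mul_le (by omega) _ hXH hm1 hmN hA hs
      (ElementStore.blind_value_le hε hHε (by omega) hX1 hX2)
    -- Rounding in `m = N / H` costs at most a factor 2. Then `n² ≤ 4K²m²` and `ε/2 * m² ≤ 2sn`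
    -- combine to the constant `ε/16`.
    have e1 : ((N : ℝ) + 1) ≤ 2 * ((H + 1 : ℕ) * m) := by
      have : N + 1 ≤ 2 * ((H + 1) * m) := by nlinarith
      exact_mod_cast this
    have e2 : (m : ℝ) ≤ N + 1 := by exact_mod_cast hmle
    have e3 : ε / 2 * (m : ℝ) ^ 2 ≤ s * (2 * (N + 1)) := by
      have : (s : ℝ) * m ≤ s * (N + 1) := mul_le_mul_of_nonneg_left e2 (Nat.cast_nonneg s)
      nlinarith
    have e4 : ((N : ℝ) + 1) ^ 2 ≤ (2 * ((H + 1 : ℕ) * m)) ^ 2 :=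
      pow_le_pow_left₀ (by positivity) e1 2
    have e5 : ε / 16 * ((N : ℝ) + 1) * (N + 1) ≤ s * ((H + 1 : ℕ) : ℝ) ^ 2 * (N + 1) := by
      calc ε / 16 * ((N : ℝ) + 1) * (N + 1) = ε / 16 * ((N : ℝ) + 1) ^ 2 := by ring
        _ ≤ ε / 16 * (2 * ((H + 1 : ℕ) * m)) ^ 2 := by gcongr
        _ = ((H + 1 : ℕ) : ℝ) ^ 2 / 2 * (ε / 2 * (m : ℝ) ^ 2) := by ring
        _ ≤ ((H + 1 : ℕ) : ℝ) ^ 2 / 2 * (s * (2 * (N + 1))) := by gcongr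
        _ = _ := by ring
    have e6 := le_of_mul_le_mul_right e5 (by positivity)
    refine le_trans ?_ e6
    push_cast
    exact mul_le_mul_of_nonneg_right (min_le_left _ _) (by positivity)
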